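/- For $d\in\mathbb N$, a $d$-VASS consists of a finite set $Q$ of states and a finite set of transitions in $Q\times\mathbb Z^d\times Q$. Its configurations are pairs $q(v)$ with $q\in Q$, $v\in\mathbb N^d$; a transition $(p,t,q)$ leads from $p(v)$ to $q(v+t)$ whenever $v+t\in\mathbb N^d$, and $c\longrightarrow c'$ means that a finite sequence of such steps leads from $c$ to $c'$. Its size is the total number of bits needed to represent its states and transitions (numbers in binary). For $f:\mathbb N\to\mathbb N$ and $d\ge 3$, a $d$-VASS with an input state $p_{\mathrm{in}}$, an output state $p_{\mathrm{out}}$ and a set $T\subseteq\{1,\dots,d-3\}$ of test counters is an $f$-amplifier if for every $M\in\mathbb N$: (i) for every $x\in\mathbb N$, if $p_{\mathrm{in}}(M,x,Mx,0^{d-3})\longrightarrow p_{\mathrm{out}}(v,b,y,z)$ with $v\in\mathbb N^{d-3}$ and $v[t]=0$ for all $t\in T$, then $v=0^{d-3}$, $b=f(M)$ and $z=by$; (ii) for every $y\in\mathbb N$ there is $x\in\mathbb N$ with $p_{\mathrm{in}}(M,x,Mx,0^{d-3})\longrightarrow p_{\mathrm{out}}(0^{d-3},f(M),y,f(M)\cdot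 y)$. Let $F_1(n)=2n$ and, for $k>1$, let $F_k(n)$ be the result of applying $F_{k-1}$ exactly $n$ times to $1$ (so $F_k(0)=1$ for $k>1$). **Lemma.** There is a constant $C\in\mathbb N$ such that for every $k\ge 1$ there is a $6k$-VASS of size at most $C^k$ which, with a suitable input state, output state and set of at most four test counters, is an $F_k$-amplifier. -/

import Mathlib

/-- A `d`-dimensional vector addition system with states: a finite set of states and a finite
set of transitions `(p, t, q)` with `t ∈ ℤ^d`. -/
structure VASS (d : ℕ) where
  State : Type
  [fintypeState : Fintype State]
  transitions : Finset (State × (Fin d → ℤ) × State)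

attribute [instance] VASS.fintypeState

namespace VASS

variable {d : ℕ}

/-- Configurations `q(v)` with `v ∈ ℕ^d`. -/
abbrev Conf (V : VASS d) : Type := V.State × (Fin d → ℕ)

/-- The transition `t` can be fired in `c` and leads to `c'`; as the counter values of `c'` are
natural numbers, the sum of the vector of `c` and the effect of `t` is required to be nonnegative. -/
def Fires (V : VASS d) (t : V.State × (Fin d → ℤ) × V.State) (c c' : V.Conf) : Prop :=
  t ∈ V.transitions ∧ t.1 = c.1 ∧ t.2.2 = c'.1 ∧ ∀ i, (c'.2 i : ℤ) = (c.2 i : ℤ) + t.2.1 i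

/-- One step of the VASS. -/
def Step (V : VASS d) (c c' : V.Conf) : Prop := ∃ t, V.Fires t c c'

/-- There is a run from `c` to `c'`. -/
def Reaches (V : VASS d) : V.Conf → V.Conf → Prop := Relation.ReflTransGen V.Step

/-- Number of bits of an integer written in binary with a sign bit. -/
def intBits (z : ℤ) : ℕ := 1 + Nat.size z.natAbs

/-- Number of bits used to write down the name of one state. -/
def stateBits (V : VASS d) : ℕ := Nat.size (Fintype.card V.State)

/-- The size of a VASS: the total number of bits needed to represent its states (each by a
binary name) and its transitions (two state names and a vector of integers in binary). -/
def size (V : VASS d) : ℕ :=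
  Fintype.card V.State * V.stateBits +
    ∑ t ∈ V.transitions, (V.stateBits + (∑ i, intBits (t.2.1 i)) + V.stateBits)

end VASS

/-- The vector `(a, b, c, 0, …, 0) ∈ ℕ^d`. -/
def inputVec (d : ℕ) (a b c : ℕ) : Fin d → ℕ := fun i =>
  if i.val = 0 then a else if i.val = 1 then b else if i.val = 2 then c else 0

/-- The vector `(0, …, 0, a, b, c) ∈ ℕ^d`. -/
def outputVec (d : ℕ) (a b c : ℕ) : Fin d → ℕ := fun i =>
  if i.val + 3 = d then a else if i.val + 2 = d then b else if i.val + 1 = d then c else 0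

/-- The VASS `V` with input state `pin`, output state `pout` and set `T` of test counters is an
`f`-amplifier. The first three counters are the input counters, the last three are the output
counters, and the test counters are among the counters that are not output counters. -/
structure IsAmplifier {d : ℕ} (f : ℕ → ℕ) (V : VASS d) (pin pout : V.State)
    (T : Finset (Fin d)) : Prop where
  three_le : 3 ≤ d
  test_lt : ∀ t ∈ T, t.val + 3 < d
  /-- If the test counters are zero in the output state, then so are all the counters except
  the output ones, which have the form `(f(M), y, f(M) · y)`. -/
  sound : ∀ (M x : ℕ) (w : Fin d → ℕ),
    V.Reaches (pin, inputVec d M x (M * x)) (pout, w) → (∀ t ∈ T, w t = 0) →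
      ∃ y : ℕ, w = outputVec d (f M) y (f M * y)
  /-- Every such triple can be output. -/
  complete : ∀ M y : ℕ, ∃ x : ℕ,
    V.Reaches (pin, inputVec d M x (M * x)) (pout, outputVec d (f M) y (f M * y))

/-- The fast-growing hierarchy: `F₁(n) = 2n` and `F_k(n)` is the `n`-fold application of `F_{k-1}`
to `1` for `k > 1`. The value at index `0` is irrelevant. -/
def fastGrowing : ℕ → ℕ → ℕ
  | 0 => fun _ => 0
  | 1 => fun n => 2 * n
  | k + 2 => fun n => (fastGrowing (k + 1))^[n] 1

/-! The proof is an induction on `k`; each level adds six counters and enlarges the numbers of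
states and transitions and the entries of the transitions by a constant factor.

Zero tests are replaced by a budget. The input `(M, x, M * x)` gives counters `c` and `D` with `D =
M * c`. Every simulated step takes two units of `c` and runs loops that can take at most `2 * M`
units of `D`, so the slack, `D` minus `M * c` minus the loop iterations still possible, starts at
zero and never decreases. If `c` and `D` are both empty at the end, the slack was always zero and
every loop ran to exhaustion. This proves the base case `doublingVASS.isAmplifier`. It also makes
exact the compilation of a `Program`, whose steps may add a multiple of a loop counter to an
accumulator (`reaches_of_compile_reaches`, `compile_reaches_of_reaches`).

To iterate an amplifier `M` times, its test counters must vanish after each run, and its output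
counters after each copying back to the input. The accumulator checks this: changing a counter by
one changes it by the number of tests of that counter still ahead. At the end it holds the sum of
all tested values, so it is zero only if every test succeeded (`IterInv.step`). Hence three test
counters suffice: `c`, `D` and the accumulator. -/

namespace VASS

/-! ### VASS given by families of transitions, and a size bound -/

open Classical in
/-- The VASS with transitions given by an indexed family. -/
noncomputable def ofEdges {d : ℕ} {S E : Type} [Fintype S] [Fintype E]
    (edge : E → S × (Fin d → ℤ) × S) : VASS d where
  State := S
  transitions := Finset.univ.image edge

variable {d : ℕ} {S E : Type} [Fintype S] [Fintype E]

theorem mem_ofEdges_transitions (edge : E → S × (Fin d → ℤ) × S) (t : S × (Fin d → ℤ) × S) :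
    t ∈ (ofEdges edge).transitions ↔ ∃ e, edge e = t := by
  classical
  exact Finset.mem_image.trans (by simp)

theorem ofEdges_step_iff (edge : E → S × (Fin d → ℤ) × S) (c c' : (ofEdges edge).Conf) :
    (ofEdges edge).Step c c' ↔ ∃ e, (edge e).1 = c.1 ∧ (edge e).2.2 = c'.1 ∧
      ∀ i, (c'.2 i : ℤ) = (c.2 i : ℤ) + (edge e).2.1 i := by
  constructor
  · rintro ⟨t, ht, h⟩
    obtain ⟨e, rfl⟩ := (mem_ofEdges_transitions edge t).1 ht
    exact ⟨e, h⟩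
  · rintro ⟨e, h⟩
    exact ⟨edge e, (mem_ofEdges_transitions edge _).2 ⟨e, rfl⟩, h⟩

theorem ofEdges_step (edge : E → S × (Fin d → ℤ) × S) (e : E) {p q : S} {v w : Fin d → ℕ}
    (hp : (edge e).1 = p) (hq : (edge e).2.2 = q)
    (h : ∀ i, (w i : ℤ) = (v i : ℤ) + (edge e).2.1 i) :
    (ofEdges edge).Step (p, v) (q, w) :=
  (ofEdges_step_iff _ _ _).2 ⟨e, hp, hq, h⟩

theorem card_ofEdges_transitions_le (edge : E → S × (Fin d → ℤ) × S) :
    (ofEdges edge).transitions.card ≤ Fintype.card E := by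
  classical
  exact Finset.card_image_le

theorem ofEdges_effect_le (edge : E → S × (Fin d → ℤ) × S) {B : ℤ}
    (h : ∀ e i, |(edge e).2.1 i| ≤ B) :
    ∀ t ∈ (ofEdges edge).transitions, ∀ i, |t.2.1 i| ≤ B := by
  intro t ht i
  obtain ⟨e, rfl⟩ := (mem_ofEdges_transitions edge t).1 ht
  exact h e i

theorem Reaches.congr {V : VASS d} {p q : V.State} {v v' w w' : Fin d → ℕ}
    (h : V.Reaches (p, v) (q, w)) (hv : v = v') (hw : w = w') : V.Reaches (p, v') (q, w') :=
  hv ▸ hw ▸ h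

/-- If there are at most `a` states and transitions and the entries of the transitions are bounded
by `a`, then the size is polynomial in `a` and the dimension. -/
theorem size_le (V : VASS d) {a : ℕ} (hS : Fintype.card V.State ≤ a)
    (hT : V.transitions.card ≤ a) (hB : ∀ t ∈ V.transitions, ∀ i, |t.2.1 i| ≤ (a : ℤ)) :
    V.size ≤ a * a + a * (a + d * (1 + a) + a) := by
  have hs : V.stateBits ≤ a := (Nat.size_le.2 Nat.lt_two_pow_self).trans hS
  unfold size
  refine add_le_add (Nat.mul_le_mul hS hs) ?_
  refine (Finset.sum_le_card_nsmul _ _ (a + d * (1 + a) + a) fun t ht => ?_).trans ?_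
  · refine add_le_add (add_le_add hs ?_) hs
    refine (Finset.sum_le_card_nsmul _ _ (1 + a) fun i _ => ?_).trans (by simp)
    have h1 : (t.2.1 i).natAbs ≤ a := by have := hB t ht i; zify; exact this
    exact Nat.add_le_add_left ((Nat.size_le.2 Nat.lt_two_pow_self).trans h1) 1
  · simpa using Nat.mul_le_mul_right _ hT

end VASS

/-! ### The base case: doubling -/

/-- The transitions of the amplifier for doubling. -/
def doublingEdge : Fin 7 → Fin 4 × (Fin 6 → ℤ) × Fin 4 :=
  ![(0, ![0, -2, 0, 0, 1, 0], 1),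
    (1, ![-1, 0, -1, 1, 0, 1], 1),
    (1, ![0, 0, 0, 0, 0, 0], 2),
    (2, ![1, 0, -1, -1, 0, 1], 2),
    (2, ![0, 0, 0, 0, 0, 0], 0),
    (0, ![0, 0, 0, 0, 0, 0], 3),
    (3, ![-1, 0, 0, 2, 0, 0], 3)]

/-- A `6`-VASS that is an amplifier for doubling. -/
noncomputable def doublingVASS : VASS 6 := VASS.ofEdges doublingEdge

namespace doublingVASS

/-- An invariant of the runs that start in `(M, x, M * x, 0, 0, 0)`. -/
def Inv (M x : ℕ) (q : Fin 4) (w : Fin 6 → ℕ) : Prop :=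
  w 2 + w 5 = M * x ∧ w 1 + 2 * w 4 = x ∧
    match q with
    | 0 => w 0 + w 3 = M ∧ M * w 1 ≤ w 2 ∧ (w 2 = M * w 1 → w 3 = 0)
    | 1 => w 0 + w 3 = M ∧ M * w 1 + M + w 0 ≤ w 2
    | 2 => w 0 + w 3 = M ∧ M * w 1 + w 3 ≤ w 2
    | 3 => M * w 1 ≤ w 2 ∧ (w 2 = M * w 1 → 2 * w 0 + w 3 = 2 * M)

/-- A loop iteration takes one unit both from `w 2` and from the iterations still possible; leaving
a loop early only adds slack. Entering a round turns `2 * M` of `M * w 1` into two passes of at most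
`M` iterations each. -/
theorem Inv.step {M x : ℕ} {c c' : Fin 4 × (Fin 6 → ℕ)} (h : Inv M x c.1 c.2)
    (hs : doublingVASS.Step c c') : Inv M x c'.1 c'.2 := by
  obtain ⟨e, h1, h2, h3⟩ := (VASS.ofEdges_step_iff _ _ _).1 hs
  obtain ⟨p, w⟩ := c
  obtain ⟨q, w'⟩ := c'
  fin_cases e <;>
  · simp [doublingEdge, Fin.forall_fin_succ] at h1 h2 h3
    subst h1 h2
    simp only [Inv] at h ⊢
    obtain ⟨e0, e1, e2, e3, e4, e5⟩ := h3
    -- `omega` treats `M * w 1` as an atom, so the change of `w 1` is expanded first.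
    try rw [show w 1 = w' 1 + 2 by omega, mul_add] at h
    try rw [show w 1 = w' 1 by omega] at h
    omega

theorem move_right (n b c d b' c' d' : ℕ) :
    doublingVASS.Reaches ((1 : Fin 4), ![b + n, c, d + n, b', c', d'])
      ((1 : Fin 4), ![b, c, d, b' + n, c', d' + n]) := by
  induction n generalizing b' d' with
  | zero => exact .refl
  | succ n ih =>
    refine .head (VASS.ofEdges_step _ 1 rfl rfl
      (w := ![b + n, c, d + n, b' + 1, c', d' + 1]) ?_) ?_
    · simp [doublingEdge, Fin.forall_fin_succ]; omega
    · exact (ih (b' + 1) (d' + 1)).congr rfl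
        (by ext i; fin_cases i <;> simp <;> omega)

theorem move_left (n b c d b' c' d' : ℕ) :
    doublingVASS.Reaches ((2 : Fin 4), ![b, c, d + n, b' + n, c', d'])
      ((2 : Fin 4), ![b + n, c, d, b', c', d' + n]) := by
  induction n generalizing b d' with
  | zero => exact .refl
  | succ n ih =>
    refine .head (VASS.ofEdges_step _ 3 rfl rfl
      (w := ![b + 1, c, d + n, b' + n, c', d' + 1]) ?_) ?_
    · simp [doublingEdge, Fin.forall_fin_succ]; omega
    · exact (ih (b + 1) (d' + 1)).congr rfl
        (by ext i; fin_cases i <;> simp <;> omega)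

theorem double (n b' c' d' : ℕ) :
    doublingVASS.Reaches ((3 : Fin 4), ![n, 0, 0, b', c', d'])
      ((3 : Fin 4), ![0, 0, 0, b' + 2 * n, c', d']) := by
  induction n generalizing b' with
  | zero => exact .refl
  | succ n ih =>
    refine .head (VASS.ofEdges_step _ 6 rfl rfl (w := ![n, 0, 0, b' + 2, c', d']) ?_) ?_
    · simp [doublingEdge, Fin.forall_fin_succ]
    · exact (ih (b' + 2)).congr rfl
        (by ext i; fin_cases i <;> simp; omega)

theorem round (M c d c' d' : ℕ) :
    doublingVASS.Reaches ((0 : Fin 4), ![M, c + 2, d + 2 * M, 0, c', d'])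
      ((0 : Fin 4), ![M, c, d, 0, c' + 1, d' + 2 * M]) := by
  have h1 : doublingVASS.Step ((0 : Fin 4), ![M, c + 2, d + 2 * M, 0, c', d'])
      ((1 : Fin 4), ![0 + M, c, (d + M) + M, 0, c' + 1, d']) :=
    VASS.ofEdges_step _ 0 rfl rfl (by simp [doublingEdge, Fin.forall_fin_succ]; ring)
  have h2 := move_right M 0 c (d + M) 0 (c' + 1) d'
  have h3 : doublingVASS.Step ((1 : Fin 4), ![0, c, d + M, 0 + M, c' + 1, d' + M])
      ((2 : Fin 4), ![0, c, d + M, 0 + M, c' + 1, d' + M]) :=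
    VASS.ofEdges_step _ 2 rfl rfl (by simp [doublingEdge, Fin.forall_fin_succ])
  have h4 := move_left M 0 c d 0 (c' + 1) (d' + M)
  have h5 : doublingVASS.Step ((2 : Fin 4), ![0 + M, c, d, 0, c' + 1, d' + M + M])
      ((0 : Fin 4), ![M, c, d, 0, c' + 1, d' + 2 * M]) :=
    VASS.ofEdges_step _ 4 rfl rfl (by simp [doublingEdge, Fin.forall_fin_succ]; ring)
  exact (((h2.head h1).tail h3).trans h4).tail h5

theorem rounds (M y c' d' : ℕ) :
    doublingVASS.Reaches ((0 : Fin 4), ![M, 2 * y, M * (2 * y), 0, c', d'])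
      ((0 : Fin 4), ![M, 0, 0, 0, c' + y, d' + 2 * M * y]) := by
  induction y generalizing c' d' with
  | zero => exact .refl
  | succ y ih =>
    have h := (round M (2 * y) (M * (2 * y)) c' d').trans (ih (c' + 1) (d' + 2 * M))
    refine VASS.Reaches.congr h ?_ ?_ <;> ext i <;> fin_cases i <;> simp <;> ring

theorem isAmplifier :
    IsAmplifier (fun n => 2 * n) doublingVASS (0 : Fin 4) (3 : Fin 4) {0, 1, 2} where
  three_le := by norm_num
  test_lt := by decide
  sound M x w h hT := by
    have h0 : Inv M x 0 (inputVec 6 M x (M * x)) := by simp [Inv, inputVec]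
    have h1 : Inv M x 3 w := by
      have : ∀ c, doublingVASS.Reaches ((0 : Fin 4), inputVec 6 M x (M * x)) c →
          Inv M x c.1 c.2 := fun c hc => by
        induction hc with
        | refl => exact h0
        | tail _ hs ih => exact ih.step hs
      exact this _ h
    simp at hT
    obtain ⟨e0, e1, e2⟩ := hT
    simp only [Inv, e0, e1, e2] at h1
    obtain ⟨h1, h2, -, h3⟩ := h1
    refine ⟨w 4, ?_⟩
    -- Both budget counters are empty, so the slack is zero and the exact clause applies.
    have h3 := h3 (by simp)
    have h5 : w 5 = 2 * M * w 4 := by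
      rw [← h2] at h1
      linarith
    funext i
    fin_cases i <;> simp [outputVec] <;> omega
  complete M y := by
    -- A round takes two units of `c` for each unit of `y`.
    refine ⟨2 * y, ?_⟩
    have h1 := rounds M y 0 0
    have h2 : doublingVASS.Step ((0 : Fin 4), ![M, 0, 0, 0, 0 + y, 0 + 2 * M * y])
      ((3 : Fin 4), ![M, 0, 0, 0, 0 + y, 0 + 2 * M * y]) :=
      VASS.ofEdges_step _ 5 rfl rfl (by simp [doublingEdge, Fin.forall_fin_succ])
    have h3 := (h1.tail h2).trans (double M 0 (0 + y) (0 + 2 * M * y))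
    refine VASS.Reaches.congr h3 ?_ ?_ <;> ext i <;> fin_cases i <;> simp [inputVec, outputVec]

end doublingVASS

/-! ### Vectors with six additional counters -/

section Cat

variable {d : ℕ} {α : Type*}

/-- Six new counters followed by `d` old ones. -/
def cat6 (a : Fin 6 → α) (v : Fin d → α) : Fin (d + 6) → α := fun i =>
  if h : i.val < 6 then a ⟨i.val, h⟩ else v ⟨i.val - 6, by omega⟩

/-- The new counters. -/
def lo (w : Fin (d + 6) → α) : Fin 6 → α := fun i => w ⟨i.val, by omega⟩

/-- The old counters. -/
def hi (w : Fin (d + 6) → α) : Fin d → α := fun i => w ⟨i.val + 6, by omega⟩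

@[simp] theorem lo_cat6 (a : Fin 6 → α) (v : Fin d → α) : lo (cat6 a v) = a := by
  ext i; simp [lo, cat6]

@[simp] theorem hi_cat6 (a : Fin 6 → α) (v : Fin d → α) : hi (cat6 a v) = v := by
  ext i; simp [hi, cat6]

theorem forall_fin_add_six {P : Fin (d + 6) → Prop} :
    (∀ i, P i) ↔ (∀ i : Fin 6, P ⟨i.val, by omega⟩) ∧ ∀ i : Fin d, P ⟨i.val + 6, by omega⟩ := by
  refine ⟨fun h => ⟨fun i => h _, fun i => h _⟩, fun ⟨h1, h2⟩ i => ?_⟩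
  by_cases hi : i.val < 6
  · exact h1 ⟨i.val, hi⟩
  · have := h2 ⟨i.val - 6, by omega⟩
    simpa [Nat.sub_add_cancel (not_lt.1 hi)] using this

theorem cat6_lo_hi (w : Fin (d + 6) → α) : cat6 (lo w) (hi w) = w := by
  rw [funext_iff, forall_fin_add_six]
  exact ⟨fun i => by simp [cat6, lo], fun i => by simp [cat6, hi]⟩

theorem add_cat6_iff (w w' : Fin (d + 6) → ℕ) (a : Fin 6 → ℤ) (t : Fin d → ℤ) :
    (∀ i, (w' i : ℤ) = (w i : ℤ) + cat6 a t i) ↔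
      (∀ i, ((lo w' i : ℕ) : ℤ) = (lo w i : ℕ) + a i) ∧
        ∀ i, ((hi w' i : ℕ) : ℤ) = (hi w i : ℕ) + t i := by
  rw [forall_fin_add_six]
  simp [lo, hi, cat6]

theorem cat6_abs_le {a : Fin 6 → ℤ} {t : Fin d → ℤ} {B : ℤ} (ha : ∀ i, |a i| ≤ B)
    (ht : ∀ i, |t i| ≤ B) (i : Fin (d + 6)) : |cat6 a t i| ≤ B := by
  unfold cat6
  split_ifs
  exacts [ha _, ht _]

end Cat

/-! ### Programs with a loop counter, and their compilation to VASS -/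

/-- A program acts on `d` counters, a loop counter `n` and an accumulator `e`. An edge decreases `n`
by `dec`, adds `eff` to the counters and then `const + coef * n` to the accumulator. -/
structure Program (d : ℕ) where
  State : Type
  Edge : Type
  [fintypeState : Fintype State]
  [fintypeEdge : Fintype Edge]
  src : Edge → State
  tgt : Edge → State
  eff : Edge → Fin d → ℤ
  dec : Edge → ℕ
  const : Edge → ℤ
  coef : Edge → ℤ

attribute [instance] Program.fintypeState Program.fintypeEdge

namespace Program

variable {d : ℕ}

/-- A state, the value of the loop counter, the counters and the accumulator. -/
abbrev Conf (P : Program d) : Type := P.State × ℕ × (Fin d → ℕ) × ℕ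

/-- One step of a program. -/
def Step (P : Program d) (c c' : P.Conf) : Prop :=
  ∃ t, P.src t = c.1 ∧ P.tgt t = c'.1 ∧ c.2.1 = c'.2.1 + P.dec t ∧
    (∀ i, (c'.2.2.1 i : ℤ) = (c.2.2.1 i : ℤ) + P.eff t i) ∧
    -- The compiled VASS adds `const` before the multiples of `coef`, so this intermediate value
    -- must be a counter value too.
    0 ≤ (c.2.2.2 : ℤ) + P.const t ∧
    (c'.2.2.2 : ℤ) = (c.2.2.2 : ℤ) + P.const t + P.coef t * c'.2.1

/-- Runs of a program. -/
def Reaches (P : Program d) : P.Conf → P.Conf → Prop := Relation.ReflTransGen P.Step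

/-- The states of the compiled program: those of the program, four states for each edge, and a
final state. -/
abbrev CState (P : Program d) : Type := Option (P.State ⊕ P.Edge × Fin 4)

/-- The state `s` of the program. -/
abbrev base (P : Program d) (s : P.State) : P.CState := some (.inl s)

/-- The `i`-th state of the simulation of the edge `t`. -/
abbrev mid (P : Program d) (t : P.Edge) (i : Fin 4) : P.CState := some (.inr (t, i))

/-- The transitions of the compiled program. The new counters `j, c, D, j', j'', e` are the loop
counter, the two counters of the budget `D = M * c` of loop iterations, the
complement of the loop counter, an auxiliary counter with `j + j' + j'' = M`, and the accumulator. -/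
def compileEdge (P : Program d) (final : P.State) :
    (P.Edge × Fin 9) ⊕ Fin 2 → P.CState × (Fin (d + 6) → ℤ) × P.CState
  | .inl (t, i) =>
    -- The loops move `j` to `j''`, `j'` to `j`, `j` back to `j'`, and `j''` back to `j`. The first
    -- one adds `coef`; the two in the middle only bring the total to `2 * M` iterations, whatever
    -- `j` is.
    ![(P.base (P.src t), cat6 (α := ℤ) ![-P.dec t, -2, 0, P.dec t, 0, P.const t] (P.eff t), P.mid t 0),
      (P.mid t 0, cat6 (α := ℤ) ![-1, 0, -1, 0, 1, P.coef t] 0, P.mid t 0),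
      (P.mid t 0, cat6 (α := ℤ) ![0, 0, 0, 0, 0, 0] 0, P.mid t 1),
      (P.mid t 1, cat6 (α := ℤ) ![1, 0, -1, -1, 0, 0] 0, P.mid t 1),
      (P.mid t 1, cat6 (α := ℤ) ![0, 0, 0, 0, 0, 0] 0, P.mid t 2),
      (P.mid t 2, cat6 (α := ℤ) ![-1, 0, -1, 1, 0, 0] 0, P.mid t 2),
      (P.mid t 2, cat6 (α := ℤ) ![0, 0, 0, 0, 0, 0] 0, P.mid t 3),
      (P.mid t 3, cat6 (α := ℤ) ![1, 0, -1, 0, -1, 0] 0, P.mid t 3),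
      (P.mid t 3, cat6 (α := ℤ) ![0, 0, 0, 0, 0, 0] 0, P.base (P.tgt t))] i
  | .inr i =>
    -- The unit of `c` must be matched by `M` decrements of `j'`, which tests that `j = 0`.
    ![(P.base final, cat6 (α := ℤ) ![0, -1, 0, 0, 0, 0] 0, none),
      (none, cat6 (α := ℤ) ![0, 0, -1, -1, 0, 0] 0, none)] i

/-- The VASS that simulates a program. -/
noncomputable def compile (P : Program d) (final : P.State) : VASS (d + 6) :=
  VASS.ofEdges (P.compileEdge final)

/-! ### Soundness of the compilation -/

section Sound

/-- An invariant of the simulation: the budget never suffices for more than all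
loop iterations, and if none was lost then the simulation is exact. -/
def Inv (P : Program d) (init final : P.State) (M : ℕ) (q : P.CState) (a : Fin 6 → ℕ)
    (v : Fin d → ℕ) : Prop :=
  match q with
  | some (.inl s) => a 0 + a 3 + a 4 = M ∧ M * a 1 ≤ a 2 ∧
      (a 2 = M * a 1 → a 4 = 0 ∧ P.Reaches (init, M, 0, 0) (s, a 0, v, a 5))
  | some (.inr (t, 0)) => a 0 + a 3 + a 4 = M ∧ M * a 1 + M + a 0 + a 3 ≤ a 2 ∧
      (a 2 = M * a 1 + M + a 0 + a 3 → ∃ (u : Fin d → ℕ) (e : ℕ),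
        P.Reaches (init, M, 0, 0) (P.src t, a 0 + a 4 + P.dec t, u, e) ∧
        (∀ i, (v i : ℤ) = (u i : ℤ) + P.eff t i) ∧ 0 ≤ (e : ℤ) + P.const t ∧
        (a 5 : ℤ) = e + P.const t + P.coef t * a 4)
  | some (.inr (t, 1)) => a 0 + a 3 + a 4 = M ∧ M * a 1 + M + a 3 ≤ a 2 ∧
      (a 2 = M * a 1 + M + a 3 → P.Reaches (init, M, 0, 0) (P.tgt t, a 4, v, a 5))
  | some (.inr (t, 2)) => a 0 + a 3 + a 4 = M ∧ M * a 1 + a 0 + a 4 ≤ a 2 ∧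
      (a 2 = M * a 1 + a 0 + a 4 → P.Reaches (init, M, 0, 0) (P.tgt t, a 4, v, a 5))
  | some (.inr (t, 3)) => a 0 + a 3 + a 4 = M ∧ M * a 1 + a 4 ≤ a 2 ∧
      (a 2 = M * a 1 + a 4 → P.Reaches (init, M, 0, 0) (P.tgt t, a 0 + a 4, v, a 5))
  | none => M * a 1 + a 3 ≤ a 2 ∧
      (a 2 = M * a 1 + a 3 → a 0 = 0 ∧ a 4 = 0 ∧
        P.Reaches (init, M, 0, 0) (final, 0, v, a 5))

variable {P : Program d} {init final : P.State} {M : ℕ}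

theorem Inv.step {c c' : P.CState × (Fin (d + 6) → ℕ)}
    (h : P.Inv init final M c.1 (lo c.2) (hi c.2)) (hs : (P.compile final).Step c c') :
    P.Inv init final M c'.1 (lo c'.2) (hi c'.2) := by
  obtain ⟨q, w⟩ := c
  obtain ⟨q', w'⟩ := c'
  obtain ⟨e, h1, h2, h3⟩ := (VASS.ofEdges_step_iff _ _ _).1 hs
  dsimp only at h h1 h2 h3 ⊢
  obtain ⟨t, i⟩ | i := e
  · fin_cases i <;> simp [compileEdge] at h1 h2 h3 <;> subst h1 h2 <;>
      rw [add_cat6_iff] at h3 <;> simp [Fin.forall_fin_succ] at h3 <;>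
      generalize lo w = a at * <;> generalize lo w' = a' at * <;>
      generalize hi w = v at * <;> generalize hi w' = v' at * <;>
      obtain ⟨⟨e0, e1, e2, e3, e4, e5⟩, hv⟩ := h3 <;>
      simp only [Inv] at h ⊢
    -- Entering an edge: the drop of `c` by two frees `2 * M` units of budget.
    on_goal 1 =>
      obtain ⟨hs, hD, hr⟩ := h
      have hc : M * a 1 = M * a' 1 + M * 2 := by rw [show a 1 = a' 1 + 2 by omega, mul_add]
      refine ⟨by omega, by omega, fun hD' => ⟨v, a 5, ?_, hv, by omega, ?_⟩⟩
      · obtain ⟨h4, hr⟩ := hr (by omega)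
        rwa [show a' 0 + a' 4 + P.dec t = a 0 by omega]
      · obtain ⟨h4, hr⟩ := hr (by omega)
        simp [e4, h4, e5]
    on_goal 1 =>
      obtain rfl : v' = v := funext hv
      rw [show a 0 = a' 0 + 1 by omega, show a 1 = a' 1 by omega, show a 3 = a' 3 by omega,
        show a 2 = a' 2 + 1 by omega] at h
      obtain ⟨hs, hD, hr⟩ := h
      refine ⟨by omega, by omega, fun hD' => ?_⟩
      obtain ⟨u, e, hr, hu, he, he'⟩ := hr (by omega)
      refine ⟨u, e, ?_, hu, he, ?_⟩
      · rwa [show a' 0 + a' 4 = a' 0 + 1 + a 4 by omega]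
      · rw [e5, he', e4]; ring
    all_goals obtain rfl : v' = v := funext hv
    · rw [← e1, ← e2, ← e3, ← e4] at h
      rw [← e0] at h
      obtain ⟨hs, hD, hr⟩ := h
      refine ⟨by omega, by omega, fun hD' => ?_⟩
      obtain ⟨u, e, hr, hu, he, he'⟩ := hr (by omega)
      -- Zero slack means that the first loop emptied `j`, so `coef` was added once per unit of the
      -- loop counter and the program step is complete.
      rw [show a' 0 = 0 by omega, zero_add] at hr
      refine hr.tail ⟨t, rfl, rfl, rfl, hu, he, ?_⟩
      rw [e5, he']
    · rw [show a 1 = a' 1 by omega, show a 3 = a' 3 + 1 by omega, show a 2 = a' 2 + 1 by omega,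
        ← e4, ← e5] at h
      obtain ⟨hs, hD, hr⟩ := h
      exact ⟨by omega, by omega, fun hD' => hr (by omega)⟩
    · rw [← e0, ← e1, ← e2, ← e3, ← e4, ← e5] at h
      obtain ⟨hs, hD, hr⟩ := h
      exact ⟨by omega, by omega, fun hD' => hr (by omega)⟩
    · rw [show a 1 = a' 1 by omega, show a 0 = a' 0 + 1 by omega, show a 2 = a' 2 + 1 by omega,
        ← e4, ← e5] at h
      obtain ⟨hs, hD, hr⟩ := h
      exact ⟨by omega, by omega, fun hD' => hr (by omega)⟩
    · rw [← e0, ← e1, ← e2, ← e3, ← e4, ← e5] at h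
      obtain ⟨hs, hD, hr⟩ := h
      refine ⟨by omega, by omega, fun hD' => ?_⟩
      have := hr (by omega)
      rwa [show a' 0 = 0 by omega, zero_add]
    · rw [show a 1 = a' 1 by omega, show a 4 = a' 4 + 1 by omega, show a 2 = a' 2 + 1 by omega,
        ← e5] at h
      obtain ⟨hs, hD, hr⟩ := h
      refine ⟨by omega, by omega, fun hD' => ?_⟩
      have := hr (by omega)
      rwa [show a' 0 + a' 4 = a 0 + (a' 4 + 1) by omega]
    · rw [← e0, ← e1, ← e2, ← e3, ← e4, ← e5] at h
      obtain ⟨hs, hD, hr⟩ := h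
      refine ⟨by omega, by omega, fun hD' => ?_⟩
      have h4 : a' 4 = 0 := by omega
      have := hr (by omega)
      rw [h4] at this
      exact ⟨h4, this⟩
  · fin_cases i <;> simp [compileEdge] at h1 h2 h3 <;> subst h1 h2 <;>
      rw [add_cat6_iff] at h3 <;> simp [Fin.forall_fin_succ] at h3 <;>
      generalize lo w = a at * <;> generalize lo w' = a' at * <;>
      generalize hi w = v at * <;> generalize hi w' = v' at * <;>
      obtain ⟨⟨e0, e1, e2, e3, e4, e5⟩, hv⟩ := h3 <;>
      simp only [Inv] at h ⊢
    all_goals obtain rfl : v' = v := funext hv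
    · obtain ⟨hs, hD, hr⟩ := h
      have hc : M * a 1 = M * a' 1 + M := by rw [show a 1 = a' 1 + 1 by omega, mul_add, mul_one]
      refine ⟨by omega, fun hD' => ?_⟩
      obtain ⟨h4, hr⟩ := hr (by omega)
      -- Zero slack here gives `j' = M`, hence `j = j'' = 0`.
      rw [show a 0 = 0 by omega] at hr
      exact ⟨by omega, by omega, e5 ▸ hr⟩
    · rw [← e0, show a 1 = a' 1 by omega, show a 3 = a' 3 + 1 by omega,
        show a 2 = a' 2 + 1 by omega, ← e4, ← e5] at h
      obtain ⟨hD, hr⟩ := h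
      exact ⟨by omega, fun hD' => hr (by omega)⟩

/-- A run of the compiled program that uses up its budget is an exact simulation. -/
theorem reaches_of_compile_reaches {x : ℕ} {w : Fin (d + 6) → ℕ}
    (h : (P.compile final).Reaches (P.base init, inputVec (d + 6) M x (M * x)) (none, w))
    (h1 : lo w 1 = 0) (h2 : lo w 2 = 0) :
    lo w 0 = 0 ∧ lo w 3 = 0 ∧ lo w 4 = 0 ∧
      P.Reaches (init, M, 0, 0) (final, 0, hi w, lo w 5) := by
  have h0 : P.Inv init final M (P.base init) (lo (inputVec (d + 6) M x (M * x)))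
      (hi (inputVec (d + 6) M x (M * x))) := by
    have : hi (inputVec (d + 6) M x (M * x)) = 0 := by
      ext i; simp [hi, inputVec]
    rw [this]
    simp [Inv, lo, inputVec]
    exact .refl
  have hI : ∀ c, (P.compile final).Reaches (P.base init, inputVec (d + 6) M x (M * x)) c →
      P.Inv init final M c.1 (lo c.2) (hi c.2) := fun c hc => by
    induction hc with
    | refl => exact h0
    | tail _ hs ih => exact ih.step hs
  obtain ⟨h3, h4⟩ := hI _ h
  simp only [h1, h2] at h3 h4
  obtain ⟨h5, h6, h7⟩ := h4 (by omega)
  exact ⟨h5, by omega, h6, h7⟩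

end Sound

/-! ### Completeness of the compilation -/

section Complete

variable {P : Program d} (init final : P.State)

theorem compile_step (e : (P.Edge × Fin 9) ⊕ Fin 2) {p q : P.CState} {a a' : Fin 6 → ℕ}
    {b : Fin 6 → ℤ} {v v' : Fin d → ℕ} {t : Fin d → ℤ}
    (he : P.compileEdge final e = (p, cat6 b t, q))
    (h : ∀ i, (a' i : ℤ) = a i + b i) (hv : ∀ i, (v' i : ℤ) = v i + t i) :
    (P.compile final).Step (p, cat6 a v) (q, cat6 a' v') := by
  refine VASS.ofEdges_step _ e (by rw [he]) (by rw [he]) ?_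
  rw [he, add_cat6_iff]
  simpa using ⟨h, hv⟩

/-- The first loop of the simulation of an edge. -/
theorem compile_loop_zero (t : P.Edge) (n j c D j' j'' e e' : ℕ) (v : Fin d → ℕ)
    (he : (e' : ℤ) = e + P.coef t * n) :
    (P.compile final).Reaches (P.mid t 0, cat6 ![j + n, c, D + n, j', j'', e] v)
      (P.mid t 0, cat6 ![j, c, D, j', j'' + n, e'] v) := by
  induction n generalizing j'' e with
  | zero =>
    obtain rfl : e' = e := by simpa using he
    exact .refl
  | succ n ih =>
    -- The partial sums are monotone, so each lies between the first and the last value, both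
    -- nonnegative.
    have hm : 0 ≤ (e : ℤ) + P.coef t := by
      rcases le_or_gt 0 (P.coef t) with h | h
      · omega
      · have : P.coef t * n ≤ 0 := mul_nonpos_of_nonpos_of_nonneg h.le (by positivity)
        push_cast at he
        linarith [Int.natCast_nonneg e']
    obtain ⟨m, hm⟩ := Int.eq_ofNat_of_zero_le hm
    refine .head (compile_step final (.inl (t, 1)) rfl
      (a' := ![j + n, c, D + n, j', j'' + 1, m]) (v' := v) ?_ (by simp)) ?_
    · simp [Fin.forall_fin_succ, hm]; omega
    · refine (ih (j'' + 1) m ?_).congr rfl ?_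
      · rw [← hm, he]; push_cast; ring
      · congr 1; ext i; fin_cases i <;> simp; omega

theorem compile_loop_one (t : P.Edge) (n j c D j' j'' e : ℕ) (v : Fin d → ℕ) :
    (P.compile final).Reaches (P.mid t 1, cat6 ![j, c, D + n, j' + n, j'', e] v)
      (P.mid t 1, cat6 ![j + n, c, D, j', j'', e] v) := by
  induction n generalizing j with
  | zero => exact .refl
  | succ n ih =>
    refine .head (compile_step final (.inl (t, 3)) rfl
      (a' := ![j + 1, c, D + n, j' + n, j'', e]) (v' := v) ?_ (by simp)) ?_
    · simp [Fin.forall_fin_succ]; omega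
    · refine (ih (j + 1)).congr rfl ?_
      congr 1; ext i; fin_cases i <;> simp; omega

theorem compile_loop_two (t : P.Edge) (n j c D j' j'' e : ℕ) (v : Fin d → ℕ) :
    (P.compile final).Reaches (P.mid t 2, cat6 ![j + n, c, D + n, j', j'', e] v)
      (P.mid t 2, cat6 ![j, c, D, j' + n, j'', e] v) := by
  induction n generalizing j' with
  | zero => exact .refl
  | succ n ih =>
    refine .head (compile_step final (.inl (t, 5)) rfl
      (a' := ![j + n, c, D + n, j' + 1, j'', e]) (v' := v) ?_ (by simp)) ?_
    · simp [Fin.forall_fin_succ]; omega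
    · refine (ih (j' + 1)).congr rfl ?_
      congr 1; ext i; fin_cases i <;> simp; omega

theorem compile_loop_three (t : P.Edge) (n j c D j' j'' e : ℕ) (v : Fin d → ℕ) :
    (P.compile final).Reaches (P.mid t 3, cat6 ![j, c, D + n, j', j'' + n, e] v)
      (P.mid t 3, cat6 ![j + n, c, D, j', j'', e] v) := by
  induction n generalizing j with
  | zero => exact .refl
  | succ n ih =>
    refine .head (compile_step final (.inl (t, 7)) rfl
      (a' := ![j + 1, c, D + n, j', j'' + n, e]) (v' := v) ?_ (by simp)) ?_
    · simp [Fin.forall_fin_succ]; omega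
    · refine (ih (j + 1)).congr rfl ?_
      congr 1; ext i; fin_cases i <;> simp; omega

theorem compile_loop_final (n c D j' e : ℕ) (v : Fin d → ℕ) :
    (P.compile final).Reaches (none, cat6 ![0, c, D + n, j' + n, 0, e] v)
      (none, cat6 ![0, c, D, j', 0, e] v) := by
  induction n with
  | zero => exact .refl
  | succ n ih =>
    refine .head (compile_step final (.inr 1) rfl
      (a' := ![0, c, D + n, j' + n, 0, e]) (v' := v) ?_ (by simp)) ih
    simp [Fin.forall_fin_succ]; omega

/-- The configuration of the compiled program with budget `c` for a configuration of the program. -/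
def encode (M c : ℕ) (κ : P.Conf) : P.CState × (Fin (d + 6) → ℕ) :=
  (P.base κ.1, cat6 ![κ.2.1, c, M * c, M - κ.2.1, 0, κ.2.2.2] κ.2.2.1)

/-- With `M = n' + r`, the exhausted loops take `n'`, `r`, `r` and `n'` units, which is exactly `2 *
M`. -/
theorem compile_reaches_of_step {M c : ℕ} {κ κ' : P.Conf} (h : P.Step κ κ') (hM : κ.2.1 ≤ M) :
    (P.compile final).Reaches (encode M (c + 2) κ) (encode M c κ') := by
  obtain ⟨s, n, v, e⟩ := κ
  obtain ⟨s', n', v', e'⟩ := κ'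
  obtain ⟨t, h1, h2, h3, h4, h5, h6⟩ := h
  dsimp only at h1 h2 h3 h4 h5 h6 hM
  subst h1 h2 h3
  obtain ⟨m, hm⟩ := Int.eq_ofNat_of_zero_le h5
  obtain ⟨r, rfl⟩ := Nat.exists_eq_add_of_le (Nat.le_of_add_right_le hM)
  set M := n' + r with hMr
  have s1 : (P.compile final).Step (encode M (c + 2) (P.src t, n' + P.dec t, v, e))
      (P.mid t 0, cat6 ![0 + n', c, (M * c + M + r) + n', r, 0, m] v') := by
    refine compile_step final (.inl (t, 0)) rfl ?_ h4
    simp [Fin.forall_fin_succ, ← hm]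
    refine ⟨?_, ?_⟩
    · push_cast [hMr]; ring
    · omega
  have l1 := compile_loop_zero final t n' 0 c (M * c + M + r) r 0 m e' v' (by rw [h6, hm])
  have s2 : (P.compile final).Step
      (P.mid t 0, cat6 ![0, c, M * c + M + r, r, 0 + n', e'] v')
      (P.mid t 1, cat6 ![0, c, M * c + M + r, 0 + r, n', e'] v') :=
    compile_step final (.inl (t, 2)) rfl (by simp [Fin.forall_fin_succ]) (by simp)
  have l2 := compile_loop_one final t r 0 c (M * c + M) 0 n' e' v'
  have s3 : (P.compile final).Step
      (P.mid t 1, cat6 ![0 + r, c, M * c + M, 0, n', e'] v')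
      (P.mid t 2, cat6 ![0 + r, c, M * c + n' + r, 0, n', e'] v') :=
    compile_step final (.inl (t, 4)) rfl (by simp [Fin.forall_fin_succ, hMr]; ring) (by simp)
  have l3 := compile_loop_two final t r 0 c (M * c + n') 0 n' e' v'
  have s4 : (P.compile final).Step
      (P.mid t 2, cat6 ![0, c, M * c + n', 0 + r, n', e'] v')
      (P.mid t 3, cat6 ![0, c, M * c + n', r, 0 + n', e'] v') :=
    compile_step final (.inl (t, 6)) rfl (by simp [Fin.forall_fin_succ]) (by simp)
  have l4 := compile_loop_three final t n' 0 c (M * c) r 0 e' v'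
  have s5 : (P.compile final).Step
      (P.mid t 3, cat6 ![0 + n', c, M * c, r, 0, e'] v') (encode M c (P.tgt t, n', v', e')) :=
    compile_step final (.inl (t, 8)) rfl (by simp [Fin.forall_fin_succ, hMr]) (by simp)
  exact ((((((((l1.head s1).tail s2).trans l2).tail s3).trans l3).tail s4).trans l4).tail s5)

/-- Each step costs two units of `c`; leaving the remaining budget arbitrary lets the simulations be
composed. -/
theorem compile_reaches_of_reaches_aux {M : ℕ} {κ κ' : P.Conf} (h : P.Reaches κ κ') :
    κ.2.1 ≤ M → ∃ N, ∀ c, (P.compile final).Reaches (encode M (c + N) κ) (encode M c κ') := by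
  induction h using Relation.ReflTransGen.head_induction_on with
  | refl => exact fun _ => ⟨0, fun c => .refl⟩
  | head hs _ ih =>
    intro hM
    obtain ⟨N, hN⟩ := ih (by obtain ⟨t, -, -, h, -⟩ := hs; omega)
    exact ⟨N + 2, fun c => (compile_reaches_of_step final hs hM).trans (hN c)⟩

/-- Every run of the program is simulated, given a suitable budget. -/
theorem compile_reaches_of_reaches {M : ℕ} {v : Fin d → ℕ}
    (h : P.Reaches (init, M, 0, 0) (final, 0, v, 0)) :
    ∃ x, (P.compile final).Reaches (P.base init, inputVec (d + 6) M x (M * x))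
      (none, cat6 0 v) := by
  obtain ⟨N, hN⟩ := compile_reaches_of_reaches_aux final h (M := M) le_rfl
  -- The additional unit pays for the final loop.
  refine ⟨1 + N, ?_⟩
  have s : (P.compile final).Step (encode M 1 (final, 0, v, 0))
      (none, cat6 ![0, 0, 0 + M, 0 + M, 0, 0] v) :=
    compile_step final (.inr 0) rfl (by simp [Fin.forall_fin_succ]) (by simp)
  refine VASS.Reaches.congr (((hN 1).tail s).trans (compile_loop_final final M 0 0 0 0 v)) ?_ ?_
  · rw [← cat6_lo_hi (inputVec _ _ _ _)]
    congr 1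
    ext i; fin_cases i <;> simp [lo, inputVec]
  · congr 1; ext i; fin_cases i <;> rfl

end Complete

/-! ### Size of the compiled program -/

section Size

theorem card_compile_state (P : Program d) (final : P.State) :
    Fintype.card (P.compile final).State = Fintype.card P.State + Fintype.card P.Edge * 4 + 1 := by
  change Fintype.card P.CState = _
  simp

theorem card_compile_transitions_le (P : Program d) (final : P.State) :
    (P.compile final).transitions.card ≤ Fintype.card P.Edge * 9 + 2 :=
  (VASS.card_ofEdges_transitions_le _).trans (by simp)

theorem compile_effect_le (P : Program d) (final : P.State) {B : ℤ} (hB : 2 ≤ B)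
    (heff : ∀ t i, |P.eff t i| ≤ B) (hdec : ∀ t, (P.dec t : ℤ) ≤ B) (hconst : ∀ t, |P.const t| ≤ B)
    (hcoef : ∀ t, |P.coef t| ≤ B) :
    ∀ t ∈ (P.compile final).transitions, ∀ i, |t.2.1 i| ≤ B := by
  refine VASS.ofEdges_effect_le _ ?_
  have hB0 : 0 ≤ B := by omega
  have hB1 : 1 ≤ B := by omega
  rintro (⟨t, i⟩ | i) <;> fin_cases i <;> refine cat6_abs_le ?_ ?_ <;>
    simp [Fin.forall_fin_succ, heff, hdec, hconst, hcoef, hB, hB0, hB1]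

end Size

end Program

/-! ### Weighted sums of counters, and copying outputs to inputs -/

section Sums

variable {d : ℕ}

/-- The three output counters. -/
def outputSet (d : ℕ) : Finset (Fin d) := Finset.univ.filter fun i => d ≤ i.val + 3

/-- The sum of the counters in `T` and the output counters. -/
def total {α : Type*} [AddCommMonoid α] (T : Finset (Fin d)) (v : Fin d → α) : α :=
  ∑ i ∈ T, v i + ∑ i ∈ outputSet d, v i

@[simp] theorem total_zero {α : Type*} [AddCommMonoid α] (T : Finset (Fin d)) :
    total T (0 : Fin d → α) = 0 := by
  simp [total]

theorem cast_sum_eq (T : Finset (Fin d)) {v v' : Fin d → ℕ} {t : Fin d → ℤ}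
    (h : ∀ i, (v' i : ℤ) = v i + t i) :
    ((∑ i ∈ T, v' i : ℕ) : ℤ) = (∑ i ∈ T, v i : ℕ) + ∑ i ∈ T, t i := by
  push_cast
  simp only [h, Finset.sum_add_distrib]

theorem cast_total_eq (T : Finset (Fin d)) {v v' : Fin d → ℕ} {t : Fin d → ℤ}
    (h : ∀ i, (v' i : ℤ) = v i + t i) : ((total T v' : ℕ) : ℤ) = (total T v : ℕ) + total T t := by
  unfold total
  rw [Nat.cast_add, Nat.cast_add, cast_sum_eq T h, cast_sum_eq _ h]
  ring

theorem card_outputSet_le (d : ℕ) : (outputSet d).card ≤ 3 := by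
  rw [← Finset.card_range 3]
  refine Finset.card_le_card_of_injOn (fun i => d - 1 - i.val) ?_ ?_
  · intro i hi
    have := i.isLt
    simp [outputSet] at hi ⊢
    omega
  · intro i _ j _ hij
    have := i.isLt
    have := j.isLt
    ext
    simp at hij
    omega

theorem abs_sum_le_card_mul (T : Finset (Fin d)) {t : Fin d → ℤ} {B : ℤ} (hB : 0 ≤ B)
    (h : ∀ i, |t i| ≤ B) {m : ℕ} (hT : T.card ≤ m) : |∑ i ∈ T, t i| ≤ m * B := by
  refine (Finset.abs_sum_le_sum_abs _ _).trans
    ((Finset.sum_le_card_nsmul _ _ B fun i _ => h i).trans ?_)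
  rw [nsmul_eq_mul]
  gcongr

/-- The effect of copying a unit of the `m`-th output counter to the `m`-th input counter. -/
def copyEffect (d : ℕ) (m : Fin 3) (i : Fin d) : ℤ :=
  if i.val = m.val then 1 else if i.val + 3 = d + m.val then -1 else 0

/-- The triple `(g, y, g * y)` is distributed over the input and the output counters. -/
def IsSplit (d g y : ℕ) (v : Fin d → ℕ) : Prop :=
  (∀ i, 3 ≤ i.val → i.val + 3 < d → v i = 0) ∧
    ∀ i j : Fin d, i.val < 3 → j.val + 3 = d + i.val → v i + v j = inputVec d g y (g * y) i

theorem isSplit_outputVec (hd : 6 ≤ d) (g y : ℕ) : IsSplit d g y (outputVec d g y (g * y)) := by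
  constructor
  · intro i h1 h2
    unfold outputVec
    split_ifs <;> omega
  · intro i j h1 h2
    unfold outputVec inputVec
    split_ifs <;> omega

/-- A copy preserves the sum of each pair; `6 ≤ d` keeps inputs and outputs disjoint. -/
theorem IsSplit.copy (hd : 6 ≤ d) {g y : ℕ} {v v' : Fin d → ℕ} (h : IsSplit d g y v) {m : Fin 3}
    (hv : ∀ i, (v' i : ℤ) = v i + copyEffect d m i) : IsSplit d g y v' := by
  have hm := m.isLt
  constructor
  · intro i h1 h2
    have h3 := hv i
    have h4 := h.1 i h1 h2
    unfold copyEffect at h3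
    split_ifs at h3 <;> omega
  · intro i j h1 h2
    have h3 := hv i
    have h4 := hv j
    rw [← h.2 i j h1 h2]
    unfold copyEffect at h3 h4
    split_ifs at h3 h4 <;> omega

theorem IsSplit.eq_inputVec (hd : 6 ≤ d) {g y : ℕ} {v : Fin d → ℕ} (h : IsSplit d g y v)
    (hv : ∑ i ∈ outputSet d, v i = 0) : v = inputVec d g y (g * y) := by
  rw [Finset.sum_eq_zero_iff] at hv
  simp only [outputSet, Finset.mem_filter, Finset.mem_univ, true_and] at hv
  ext i
  by_cases h1 : i.val < 3
  · have h2 := h.2 i ⟨d - 3 + i.val, by omega⟩ h1 (by simp; omega)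
    rw [hv ⟨d - 3 + i.val, by omega⟩ (by simp; omega)] at h2
    exact h2
  · have h0 : inputVec d g y (g * y) i = 0 := by
      unfold inputVec
      split_ifs <;> omega
    rw [h0]
    by_cases h2 : i.val + 3 < d
    · exact h.1 i (by omega) h2
    · exact hv i (by omega)

/-- The input counters hold `a` and the output counters hold `b`. -/
def mixVec (d : ℕ) (a₀ a₁ a₂ b₀ b₁ b₂ : ℕ) : Fin d → ℕ :=
  fun i => inputVec d a₀ a₁ a₂ i + outputVec d b₀ b₁ b₂ i

end Sums

/-! ### The program that iterates an amplifier -/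

namespace VASS

variable {d : ℕ}

/-- The program that computes the iterates of the function of an amplifier. Its states are those of
the amplifier, and the states `0` (start), `1` (loading of a triple `(1, y, y)`), `2` (between two
iterations) and `3` (copying of the output counters to the input counters). -/
def iterate (V : VASS d) (pin pout : V.State) (T : Finset (Fin d)) : Program d where
  State := V.State ⊕ Fin 4
  Edge := V.transitions ⊕ Fin 6 ⊕ Fin 3
  src := Sum.elim (fun t => .inl t.1.1)
    (Sum.elim ![.inr 0, .inr 1, .inr 1, .inr 2, .inr 3, .inl pout] fun _ => .inr 3)
  tgt := Sum.elim (fun t => .inl t.1.2.2)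
    (Sum.elim ![.inr 1, .inr 1, .inr 2, .inr 3, .inl pin, .inr 2] fun _ => .inr 3)
  eff := Sum.elim (fun t => t.1.2.1)
    (Sum.elim ![fun i => outputVec d 1 0 0 i, fun i => outputVec d 0 1 1 i, 0, 0, 0, 0]
      (copyEffect d))
  dec := Sum.elim 0 (Sum.elim ![0, 0, 0, 1, 0, 0] 0)
  -- The weight of a counter is the number of its tests ahead: `n` during loading, `n + 1` during
  -- copying, and in a run of `V` still `n + 1` for `T` but only `n` for the outputs, already tested
  -- in this iteration.
  const := Sum.elim (fun t => ∑ i ∈ T, t.1.2.1 i)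
    (Sum.elim 0 fun m => total T (copyEffect d m))
  coef t := total T ((Sum.elim (fun t => t.1.2.1)
    (Sum.elim ![fun i => outputVec d 1 0 0 i, fun i => outputVec d 0 1 1 i, 0, 0, 0, 0]
      (copyEffect d)) : V.transitions ⊕ Fin 6 ⊕ Fin 3 → Fin d → ℤ) t)

/-- An invariant of `iterate`: the accumulator bounds the values the tested counters had when they
should have been zero, and if it is minimal then the computation is exact. -/
def IterInv (V : VASS d) (pin : V.State) (T : Finset (Fin d)) (f : ℕ → ℕ) (M : ℕ)
    (s : V.State ⊕ Fin 4) (n : ℕ) (v : Fin d → ℕ) (e : ℕ) : Prop :=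
  match s with
  | .inr 0 => n = M ∧ v = 0 ∧ e = 0
  | .inr 1 => n * total T v ≤ e ∧ (e = n * total T v → n = M ∧ ∃ y, v = outputVec d 1 y y)
  | .inr 2 => n * total T v ≤ e ∧
      (e = n * total T v → n ≤ M ∧ ∃ y, v = outputVec d (f^[M - n] 1) y (f^[M - n] 1 * y))
  | .inr 3 => (n + 1) * total T v ≤ e ∧
      (e = (n + 1) * total T v → n + 1 ≤ M ∧ ∃ y, IsSplit d (f^[M - (n + 1)] 1) y v)
  | .inl q => n * total T v + ∑ i ∈ T, v i ≤ e ∧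
      (e = n * total T v + ∑ i ∈ T, v i → n + 1 ≤ M ∧
        ∃ y, V.Reaches (pin, inputVec d (f^[M - (n + 1)] 1) y (f^[M - (n + 1)] 1 * y)) (q, v))

variable {V : VASS d} {pin pout : V.State} {T : Finset (Fin d)} {f : ℕ → ℕ} {M : ℕ}

/-- The accumulator minus the weighted sum of the counters changes at the tests only: entering `pin`
adds the sum of the outputs to it, leaving `pout` the sum over `T`. Decrementing `n` is neutral, as
the weight `n + 1` replaces the old value of the loop counter. -/
theorem IterInv.step (hd : 6 ≤ d) (hV : IsAmplifier f V pin pout T)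
    {c c' : (V.iterate pin pout T).Conf}
    (h : V.IterInv pin T f M c.1 c.2.1 c.2.2.1 c.2.2.2) (hs : (V.iterate pin pout T).Step c c') :
    V.IterInv pin T f M c'.1 c'.2.1 c'.2.2.1 c'.2.2.2 := by
  obtain ⟨s, n, v, e⟩ := c
  obtain ⟨s', n', v', e'⟩ := c'
  obtain ⟨t, h1, h2, h3, h4, h5, h6⟩ := hs
  dsimp only at h h1 h2 h3 h4 h5 h6 ⊢
  obtain ⟨t, ht⟩ | t | m := t
  · simp [iterate] at h1 h2 h3 h4 h6
    subst h1 h2 h3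
    obtain ⟨h, hr⟩ := h
    have k1 := cast_total_eq T h4
    have k2 := cast_sum_eq T h4
    have key : (e' : ℤ) - (n * total T v' + ∑ i ∈ T, v' i : ℕ) =
        e - (n * total T v + ∑ i ∈ T, v i : ℕ) := by
      push_cast [h6] at k1 k2 ⊢
      rw [k1, k2]; ring
    refine ⟨by omega, fun he => ?_⟩
    obtain ⟨hn, y, hy⟩ := hr (by omega)
    exact ⟨hn, y, hy.tail ⟨t, ht, rfl, rfl, h4⟩⟩
  · fin_cases t <;> simp [iterate] at h1 h2 h3 h4 h6 <;> subst h1 h2 h3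
    · obtain ⟨rfl, rfl, rfl⟩ := h
      have k1 := cast_total_eq T h4
      obtain rfl : v' = outputVec d 1 0 0 := by
        ext i
        simpa using h4 i
      have key : (e' : ℤ) = (n * total T (outputVec d 1 0 0) : ℕ) := by
        push_cast [h6, k1]
        simp; ring
      exact ⟨by omega, fun _ => ⟨rfl, 0, rfl⟩⟩
    · obtain ⟨h, hr⟩ := h
      have k1 := cast_total_eq T h4
      have key : (e' : ℤ) - (n * total T v' : ℕ) = e - (n * total T v : ℕ) := by
        push_cast [h6]
        rw [k1]; ring
      refine ⟨by omega, fun he => ?_⟩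
      obtain ⟨hn, y, rfl⟩ := hr (by omega)
      refine ⟨hn, y + 1, funext fun i => ?_⟩
      have := h4 i
      unfold outputVec at this ⊢
      split_ifs at this ⊢ <;> omega
    · obtain rfl : v' = v := funext h4
      obtain rfl : e' = e := by simpa using h6
      obtain ⟨h, hr⟩ := h
      refine ⟨h, fun he => ?_⟩
      obtain ⟨rfl, y, rfl⟩ := hr he
      exact ⟨le_rfl, y, by simp⟩
    · obtain rfl : v' = v := funext h4
      obtain rfl : e' = e := by simpa using h6
      obtain ⟨h, hr⟩ := h
      refine ⟨h, fun he => ?_⟩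
      obtain ⟨hn, y, rfl⟩ := hr he
      exact ⟨hn, y, isSplit_outputVec hd _ _⟩
    · obtain rfl : v' = v := funext h4
      obtain rfl : e' = e := by simpa using h6
      obtain ⟨h, hr⟩ := h
      have ht : (n + 1) * total T v' =
          n * total T v' + ∑ i ∈ T, v' i + ∑ i ∈ outputSet d, v' i := by
        rw [add_mul, one_mul, add_assoc]; rfl
      refine ⟨by omega, fun he => ?_⟩
      obtain ⟨hn, y, hy⟩ := hr (by omega)
      obtain rfl := hy.eq_inputVec hd (by omega)
      exact ⟨hn, y, .refl⟩
    · obtain rfl : v' = v := funext h4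
      obtain rfl : e' = e := by simpa using h6
      obtain ⟨h, hr⟩ := h
      refine ⟨by omega, fun he => ?_⟩
      obtain ⟨hn, y, hy⟩ := hr (by omega)
      -- The weight of `T` drops from `n + 1` to `n` here, so a minimal accumulator forces this sum
      -- to vanish.
      have h0 : ∑ i ∈ T, v' i = 0 := by omega
      obtain ⟨z, hz⟩ := hV.sound _ _ _ hy (Finset.sum_eq_zero_iff.1 h0)
      refine ⟨by omega, z, ?_⟩
      rwa [← Function.iterate_succ_apply' f, show (M - (n + 1)).succ = M - n by omega] at hz
  · simp [iterate] at h1 h2 h3 h4 h6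
    subst h1 h2 h3
    obtain ⟨h, hr⟩ := h
    have k1 := cast_total_eq T h4
    have key : (e' : ℤ) - ((n + 1) * total T v' : ℕ) = e - ((n + 1) * total T v : ℕ) := by
      push_cast [h6]
      rw [k1]; ring
    refine ⟨by omega, fun he => ?_⟩
    obtain ⟨hn, y, hy⟩ := hr (by omega)
    exact ⟨hn, y, hy.copy hd h4⟩

/-- A run of `iterate` that leaves the accumulator empty is exact. -/
theorem eq_outputVec_of_iterate_reaches (hd : 6 ≤ d) (hV : IsAmplifier f V pin pout T)
    {v : Fin d → ℕ}
    (h : (V.iterate pin pout T).Reaches (.inr 0, M, 0, 0) (.inr 2, 0, v, 0)) :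
    ∃ y, v = outputVec d (f^[M] 1) y (f^[M] 1 * y) := by
  have hI : ∀ c, (V.iterate pin pout T).Reaches (.inr 0, M, 0, 0) c →
      V.IterInv pin T f M c.1 c.2.1 c.2.2.1 c.2.2.2 := fun c hc => by
    induction hc with
    | refl => exact ⟨rfl, rfl, rfl⟩
    | tail _ hs ih => exact ih.step hd hV hs
  obtain ⟨-, h⟩ := hI _ h
  -- At `n = 0` all weights vanish, so the empty accumulator is the minimal one.
  exact (h (by simp)).2

theorem iterate_step_copy (m : Fin 3) (n : ℕ) {v v' : Fin d → ℕ}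
    (h : ∀ i, (v' i : ℤ) = v i + copyEffect d m i) :
    (V.iterate pin pout T).Step (.inr 3, n, v, (n + 1) * total T v)
      (.inr 3, n, v', (n + 1) * total T v') := by
  have k1 := cast_total_eq T h
  refine ⟨.inr (.inr m), rfl, rfl, rfl, h, ?_, ?_⟩
  · change 0 ≤ (((n + 1) * total T v : ℕ) : ℤ) + total T (copyEffect d m)
    push_cast
    have h0 : 0 ≤ (n : ℤ) * (total T v : ℕ) := by positivity
    linarith [Int.natCast_nonneg (total T v')]
  · change (((n + 1) * total T v' : ℕ) : ℤ) = (((n + 1) * total T v : ℕ) : ℤ) +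
      total T (copyEffect d m) + total T (copyEffect d m) * n
    push_cast
    rw [k1]; ring

theorem iterate_reaches_copy (hd : 6 ≤ d) (n b₀ b₁ b₂ : ℕ) : ∀ a₀ a₁ a₂ : ℕ,
    (V.iterate pin pout T).Reaches
      (.inr 3, n, mixVec d a₀ a₁ a₂ b₀ b₁ b₂, (n + 1) * total T (mixVec d a₀ a₁ a₂ b₀ b₁ b₂))
      (.inr 3, n, inputVec d (a₀ + b₀) (a₁ + b₁) (a₂ + b₂),
        (n + 1) * total T (inputVec d (a₀ + b₀) (a₁ + b₁) (a₂ + b₂))) := by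
  induction b₀ with
  | succ b₀ ih =>
    intro a₀ a₁ a₂
    refine .head (iterate_step_copy 0 n (v' := mixVec d (a₀ + 1) a₁ a₂ b₀ b₁ b₂) fun i => ?_) ?_
    · simp only [mixVec, inputVec, outputVec, copyEffect, Fin.val_zero]
      split_ifs <;> omega
    · rw [show a₀ + (b₀ + 1) = a₀ + 1 + b₀ by omega]
      exact ih _ _ _
  | zero =>
    induction b₁ with
    | succ b₁ ih =>
      intro a₀ a₁ a₂
      refine .head (iterate_step_copy 1 n (v' := mixVec d a₀ (a₁ + 1) a₂ 0 b₁ b₂) fun i => ?_) ?_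
      · simp only [mixVec, inputVec, outputVec, copyEffect, Fin.val_one]
        split_ifs <;> omega
      · rw [show a₁ + (b₁ + 1) = a₁ + 1 + b₁ by omega]
        exact ih _ _ _
    | zero =>
      induction b₂ with
      | succ b₂ ih =>
        intro a₀ a₁ a₂
        refine .head (iterate_step_copy 2 n (v' := mixVec d a₀ a₁ (a₂ + 1) 0 0 b₂) fun i => ?_) ?_
        · simp only [mixVec, inputVec, outputVec, copyEffect, Fin.val_two]
          split_ifs <;> omega
        · rw [show a₂ + (b₂ + 1) = a₂ + 1 + b₂ by omega]
          exact ih _ _ _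
      | zero =>
        intro a₀ a₁ a₂
        have : mixVec d a₀ a₁ a₂ 0 0 0 = inputVec d a₀ a₁ a₂ := by
          ext i
          simp [mixVec, outputVec]
        rw [this]
        exact .refl

/-- The accumulator stays minimal. After `const` it is the old `n`-fold total plus the new sum over
`T`, hence nonnegative. -/
theorem iterate_reaches_run (n : ℕ) {c c' : V.Conf} (h : V.Reaches c c') :
    (V.iterate pin pout T).Reaches (.inl c.1, n, c.2, n * total T c.2 + ∑ i ∈ T, c.2 i)
      (.inl c'.1, n, c'.2, n * total T c'.2 + ∑ i ∈ T, c'.2 i) := by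
  induction h with
  | refl => exact .refl
  | @tail b c _ hs ih =>
    refine ih.tail ?_
    obtain ⟨t, ht, h1, h2, h3⟩ := hs
    have k1 := cast_total_eq T h3
    have k2 := cast_sum_eq T h3
    refine ⟨.inl ⟨t, ht⟩, congrArg _ h1, congrArg _ h2, rfl, h3, ?_, ?_⟩
    · change 0 ≤ ((n * total T b.2 + ∑ i ∈ T, b.2 i : ℕ) : ℤ) + ∑ i ∈ T, t.2.1 i
      rw [Nat.cast_add, add_assoc, ← k2]
      positivity
    · change ((n * total T c.2 + ∑ i ∈ T, c.2 i : ℕ) : ℤ) =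
        ((n * total T b.2 + ∑ i ∈ T, b.2 i : ℕ) : ℤ) + ∑ i ∈ T, t.2.1 i + total T t.2.1 * n
      rw [Nat.cast_add, Nat.cast_add, Nat.cast_mul, Nat.cast_mul, k1, k2]
      ring

theorem iterate_reaches_load (n y : ℕ) :
    (V.iterate pin pout T).Reaches (.inr 0, n, 0, 0)
      (.inr 1, n, outputVec d 1 y y, n * total T (outputVec d 1 y y)) := by
  induction y with
  | zero =>
    refine .single ⟨.inr (.inl 0), rfl, rfl, rfl, fun i => ?_, le_rfl, ?_⟩
    · exact (zero_add _).symm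
    · have k1 := cast_total_eq T (v := 0) (v' := outputVec d 1 0 0)
        (t := fun i => (outputVec d 1 0 0 i : ℤ)) (by simp)
      change ((n * total T (outputVec d 1 0 0) : ℕ) : ℤ) =
        0 + 0 + total T (fun i => (outputVec d 1 0 0 i : ℤ)) * n
      rw [Nat.cast_mul, k1]
      simp; ring
  | succ y ih =>
    have hv : ∀ i, ((outputVec d 1 (y + 1) (y + 1) i : ℕ) : ℤ) =
        (outputVec d 1 y y i : ℕ) + (outputVec d 0 1 1 i : ℕ) := fun i => by
      unfold outputVec
      split_ifs <;> omega
    refine ih.tail ⟨.inr (.inl 1), rfl, rfl, rfl, hv, ?_, ?_⟩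
    · exact Int.add_nonneg (by positivity) le_rfl
    · have k1 := cast_total_eq T hv
      change ((n * total T (outputVec d 1 (y + 1) (y + 1)) : ℕ) : ℤ) =
        ((n * total T (outputVec d 1 y y) : ℕ) : ℤ) + 0 +
          total T (fun i => (outputVec d 0 1 1 i : ℤ)) * n
      rw [Nat.cast_mul, k1]
      push_cast
      ring

/-- The steps of `iterate` between its parts. -/
theorem iterate_step_of_eff_eq_zero (t : Fin 6) {n n' e : ℕ} {v : Fin d → ℕ}
    {p q : V.State ⊕ Fin 4}
    (h1 : (V.iterate pin pout T).src (.inr (.inl t)) = p)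
    (h2 : (V.iterate pin pout T).tgt (.inr (.inl t)) = q)
    (h3 : n = n' + (V.iterate pin pout T).dec (.inr (.inl t)))
    (h4 : (V.iterate pin pout T).eff (.inr (.inl t)) = 0) :
    (V.iterate pin pout T).Step (p, n, v, e) (q, n', v, e) := by
  have h5 : (V.iterate pin pout T).coef (.inr (.inl t)) = 0 := by
    change total T ((V.iterate pin pout T).eff (.inr (.inl t))) = 0
    rw [h4, total_zero]
  have h6 : (V.iterate pin pout T).const (.inr (.inl t)) = 0 := rfl
  exact ⟨.inr (.inl t), h1, h2, h3, by simp [h4], by simp [h6], by simp [h5, h6]⟩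

/-- All triples are computed by `iterate`. -/
theorem iterate_reaches (hd : 6 ≤ d) (hV : IsAmplifier f V pin pout T) (n m y : ℕ) :
    (V.iterate pin pout T).Reaches (.inr 0, n + m, 0, 0)
      (.inr 2, n, outputVec d (f^[m] 1) y (f^[m] 1 * y),
        n * total T (outputVec d (f^[m] 1) y (f^[m] 1 * y))) := by
  induction m generalizing n y with
  | zero =>
    simp only [Function.iterate_zero, id, one_mul, add_zero]
    exact (iterate_reaches_load n y).tail (iterate_step_of_eff_eq_zero 2 rfl rfl rfl rfl)
  | succ m ih =>
    -- The triples are chosen backwards: the earlier iterations must output the `x` that the last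
    -- run needs.
    obtain ⟨x, hx⟩ := hV.complete (f^[m] 1) y
    rw [← Function.iterate_succ_apply' f] at hx
    set g := f^[m] 1
    have r1 := ih (n + 1) x
    rw [show n + 1 + m = n + (m + 1) by omega] at r1
    have r2 := iterate_reaches_copy (V := V) (pin := pin) (pout := pout) (T := T) hd n
      g x (g * x) 0 0 0
    have h0 : mixVec d 0 0 0 g x (g * x) = outputVec d g x (g * x) := by
      ext i
      simp [mixVec, inputVec]
    simp only [h0, zero_add] at r2
    have r3 := iterate_reaches_run (pin := pin) (pout := pout) (T := T) n hx
    have hs : (n + 1) * total T (inputVec d g x (g * x)) =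
        n * total T (inputVec d g x (g * x)) + ∑ i ∈ T, inputVec d g x (g * x) i := by
      have : ∑ i ∈ outputSet d, inputVec d g x (g * x) i = 0 := by
        refine Finset.sum_eq_zero fun i hi => ?_
        simp [outputSet] at hi
        unfold inputVec
        split_ifs <;> omega
      rw [add_mul, one_mul]
      conv_lhs => enter [2]; unfold total
      rw [this, add_zero]
    rw [hs] at r2
    have ht : ∀ b y z, ∑ i ∈ T, outputVec d b y z i = 0 := fun b y z => by
      refine Finset.sum_eq_zero fun i hi => ?_
      have := hV.test_lt i hi
      unfold outputVec
      split_ifs <;> omega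
    simp only [ht, add_zero] at r3
    exact (((r1.tail (iterate_step_of_eff_eq_zero 3 rfl rfl rfl rfl)).trans r2).tail
      (iterate_step_of_eff_eq_zero 4 rfl rfl rfl rfl)).trans
      (r3.tail (iterate_step_of_eff_eq_zero 5 rfl rfl rfl rfl))

end VASS

/-! ### The induction step and the size bound -/

/-- The test counters of the amplifier for the iterates: the two counters of the budget and the
accumulator. -/
def iterateTests (d : ℕ) : Finset (Fin (d + 6)) := {⟨1, by omega⟩, ⟨2, by omega⟩, ⟨5, by omega⟩}

/-- From an amplifier for `f` one obtains an amplifier for `n ↦ f^[n] 1`. -/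
theorem IsAmplifier.iterate {d : ℕ} {f : ℕ → ℕ} {V : VASS d} {pin pout : V.State}
    {T : Finset (Fin d)} (hd : 6 ≤ d) (hV : IsAmplifier f V pin pout T) :
    IsAmplifier (fun n => f^[n] 1) ((V.iterate pin pout T).compile (.inr 2))
      ((V.iterate pin pout T).base (.inr 0)) none (iterateTests d) where
  three_le := by omega
  test_lt := by
    intro t ht
    simp [iterateTests] at ht
    rcases ht with rfl | rfl | rfl <;> simp; omega
  sound M x w h hT := by
    simp [iterateTests] at hT
    obtain ⟨h1, h2, h5⟩ := hT
    obtain ⟨h0, h3, h4, hr⟩ := Program.reaches_of_compile_reaches h h1 h2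
    rw [show lo w 5 = 0 from h5] at hr
    obtain ⟨y, hy⟩ := VASS.eq_outputVec_of_iterate_reaches hd hV hr
    refine ⟨y, ?_⟩
    rw [funext_iff, forall_fin_add_six]
    refine ⟨fun i => ?_, fun i => ?_⟩
    · have : lo w i = 0 := by
        fin_cases i
        exacts [h0, h1, h2, h3, h4, h5]
      refine this.trans ?_
      simp only [outputVec]
      split_ifs <;> omega
    · refine (congrFun hy i).trans ?_
      simp only [outputVec]
      split_ifs <;> omega
  complete M y := by
    have h := VASS.iterate_reaches hd hV 0 M y
    rw [zero_mul, zero_add] at h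
    obtain ⟨x, hx⟩ := Program.compile_reaches_of_reaches _ _ h
    refine ⟨x, hx.congr rfl ?_⟩
    rw [funext_iff, forall_fin_add_six]
    refine ⟨fun i => ?_, fun i => ?_⟩
    · simp only [cat6, outputVec, Pi.zero_apply]
      split_ifs <;> omega
    · simp only [cat6, outputVec]
      split_ifs <;> omega

/-- The largest entries are the coefficients, sums of at most four tested and three output entries;
hence the factor `7`. -/
theorem VASS.iterate_compile_effect_le {d : ℕ} {V : VASS d} (pin pout : V.State)
    {T : Finset (Fin d)} (hT : T.card ≤ 4) {B : ℤ} (hB : 1 ≤ B)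
    (h : ∀ t ∈ V.transitions, ∀ i, |t.2.1 i| ≤ B) :
    ∀ t ∈ ((V.iterate pin pout T).compile (.inr 2)).transitions, ∀ i, |t.2.1 i| ≤ 7 * B := by
  have heff : ∀ t i, |(V.iterate pin pout T).eff t i| ≤ B := by
    rintro (⟨t, ht⟩ | t | m) i
    · exact h t ht i
    · have hout : ∀ b : ℕ, b ≤ 1 → |((outputVec d b (1 - b) (1 - b) i : ℕ) : ℤ)| ≤ B := by
        intro b hb
        unfold outputVec
        split_ifs <;> rw [abs_le] <;> omega
      fin_cases t
      · exact hout 1 le_rfl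
      · exact hout 0 zero_le_one
      all_goals exact (abs_zero (α := ℤ)).trans_le (by omega)
    · change |copyEffect d m i| ≤ B
      unfold copyEffect
      split_ifs <;> simp <;> omega
  have hsum : ∀ t, |∑ i ∈ T, (V.iterate pin pout T).eff t i| ≤ 4 * B := fun t => by
    exact_mod_cast abs_sum_le_card_mul T (by omega) (heff t) hT
  have htot : ∀ t, |total T ((V.iterate pin pout T).eff t)| ≤ 7 * B := fun t => by
    have h1 := hsum t
    have h2 := abs_sum_le_card_mul _ (by omega) (heff t) (card_outputSet_le d)
    have h3 := abs_add_le (∑ i ∈ T, (V.iterate pin pout T).eff t i)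
      (∑ i ∈ outputSet d, (V.iterate pin pout T).eff t i)
    unfold total
    push_cast at h2
    linarith
  refine Program.compile_effect_le _ _ (by omega) (fun t i => (heff t i).trans (by omega)) ?_ ?_ htot
  · rintro (t | t | m)
    · exact Int.ofNat_zero.trans_le (by omega)
    · fin_cases t <;> simp [VASS.iterate] <;> omega
    · exact Int.ofNat_zero.trans_le (by omega)
  · rintro (t | t | m)
    · exact (hsum (.inl t)).trans (by omega)
    · exact (abs_zero (α := ℤ)).trans_le (by omega)
    · exact htot (.inr (.inr m))

/-- The states, transitions and entries are bounded separately since each grows by a constant factor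
per level; `100` is a crude common bound. -/
theorem exists_isAmplifier_fastGrowing (k : ℕ) :
    ∃ (V : VASS (6 * (k + 1))) (pin pout : V.State) (T : Finset (Fin (6 * (k + 1)))),
      Fintype.card V.State ≤ 100 ^ (k + 1) ∧ V.transitions.card ≤ 100 ^ (k + 1) ∧
      (∀ t ∈ V.transitions, ∀ i, |t.2.1 i| ≤ ((100 ^ (k + 1) : ℕ) : ℤ)) ∧ T.card ≤ 4 ∧
      IsAmplifier (fastGrowing (k + 1)) V pin pout T := by
  induction k with
  | zero =>
    refine ⟨doublingVASS, (0 : Fin 4), (3 : Fin 4), {0, 1, 2}, ?_, ?_, ?_, by decide,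
      doublingVASS.isAmplifier⟩
    · exact (Fintype.card_fin 4).trans_le (by norm_num)
    · exact (VASS.card_ofEdges_transitions_le _).trans (by simp)
    · refine VASS.ofEdges_effect_le _ fun e i => ?_
      fin_cases e <;> fin_cases i <;> simp [doublingEdge]
  | succ k ih =>
    obtain ⟨V, pin, pout, T, hS, hE, hB, hT, hV⟩ := ih
    have hpos : 100 ≤ 100 ^ (k + 1) := Nat.le_self_pow (by omega) _
    have hedge : Fintype.card (V.iterate pin pout T).Edge = V.transitions.card + 9 := by
      change Fintype.card (V.transitions ⊕ Fin 6 ⊕ Fin 3) = _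
      simp
    have hstate : Fintype.card (V.iterate pin pout T).State = Fintype.card V.State + 4 := by
      change Fintype.card (V.State ⊕ Fin 4) = _
      simp
    refine ⟨(V.iterate pin pout T).compile (.inr 2), (V.iterate pin pout T).base (.inr 0), none,
      iterateTests (6 * (k + 1)), ?_, ?_, ?_, ?_, hV.iterate (by omega)⟩
    · refine (Program.card_compile_state _ _).trans_le ?_
      rw [hedge, hstate, pow_succ]
      omega
    · refine (Program.card_compile_transitions_le _ _).trans ?_
      rw [hedge, pow_succ]
      omega
    · intro t ht i
      refine (VASS.iterate_compile_effect_le pin pout hT (by omega) hB t ht i).trans ?_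
      rw [pow_succ _ (k + 1)]
      push_cast
      have : (0 : ℤ) ≤ 100 ^ (k + 1) := by positivity
      linarith
    · exact Finset.card_le_three.trans (by norm_num)

theorem lemma4 :
    ∃ C : ℕ, ∀ k : ℕ, 1 ≤ k →
      ∃ (V : VASS (6 * k)) (pin pout : V.State) (T : Finset (Fin (6 * k))),
        V.size ≤ C ^ k ∧ T.card ≤ 4 ∧ IsAmplifier (fastGrowing k) V pin pout T := by
  -- With `a = 100 ^ k`, which also bounds the dimension `6 * k`, the size is at most `a ^ 3 + 4 * a
  -- ^ 2 ≤ 5 * a ^ 3`.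
  refine ⟨5 * 100 ^ 3, fun k hk => ?_⟩
  obtain ⟨k, rfl⟩ := Nat.exists_eq_add_of_le' hk
  obtain ⟨V, pin, pout, T, hS, hE, hB, hT, hV⟩ := exists_isAmplifier_fastGrowing k
  refine ⟨V, pin, pout, T, (V.size_le hS hE hB).trans ?_, hT, hV⟩
  have h6 : 6 * (k + 1) ≤ 100 ^ (k + 1) := by
    clear * -
    induction k with
    | zero => norm_num
    | succ k ih => rw [pow_succ]; omega
  have h5 : 5 ≤ 5 ^ (k + 1) := Nat.le_self_pow (by omega) _
  have h1 : 1 ≤ 100 ^ (k + 1) := Nat.one_le_pow _ _ (by norm_num)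
  rw [mul_pow, ← pow_mul, mul_comm 3, pow_mul]
  generalize 100 ^ (k + 1) = a at *
  calc a * a + a * (a + 6 * (k + 1) * (1 + a) + a)
      ≤ a * a + a * (a + a * (1 + a) + a) := by gcongr
    _ = a ^ 3 + 4 * (a * a * 1) := by ring
    _ ≤ a ^ 3 + 4 * (a * a * a) := by gcongr
    _ = 5 * a ^ 3 := by ring
    _ ≤ 5 ^ (k + 1) * a ^ 3 := by gcongr
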